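/- Let $(\Omega,\mu)$ be a $\sigma$-finite measure space and $\mathcal H$ a separable complex Hilbert space. Let $D\subseteq L^\infty(\Omega)$ be a determining set for $L^1(\Omega)$, i.e. the only $f\in L^1(\Omega)$ with $\int_\Omega fg\,d\mu=0$ for all $g\in D$ is $f=0$. For a finite family $\Phi=(\Phi_1,\dots,\Phi_n)$ in $L^2(\Omega,\mathcal H)$ put $M_D(\Phi)=\overline{\operatorname{span}}\{g\Phi_i: g\in D,\ 1\le i\le n\}$, and for $M$ of this form let $\ell(M)$ be the least $n\in\{0,1,2,\dots\}$ such that $M=M_D(\Theta_1,\dots,\Theta_n)$ for some $\Theta_1,\dots,\Theta_n\in M$. A measurable range function is a map $J$ from $\Omega$ to the closed subspaces of $\mathcal H$ such that $\omega\mapsto\langle P_{J(\omega)}a,b\rangle$ is measurable for all $a,b\in\mathcal H$, where $P_{J(\omega)}$ is the orthogonal projection onto $J(\omega)$; it is associated to $M$ if $M=\{F\in L^2(\Omega,\mathcal H): F(\omega)\in J(\omega)\text{ for a.e. }\omega\}$. The family $\Phi$ is a uniform frame for $J$ if $J(\omega)=\overline{\operatorname{span}}\{\Phi_i(\omega): 1\le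 i\le n\}$ for a.e. $\omega$ and there are constants $0<\alpha\le\beta$ such that for a.e. $\omega$ and all $f\in J(\omega)$, $$\alpha\|f\|^2\le\sum_{i=1}^n|\langle f,\Phi_i(\omega)\rangle|^2\le\beta\|f\|^2 .$$ For subspaces $S,T$ of $\mathbb C^m$, the sine of the Friedrichs angle is $\mathcal F[S,T]=\sqrt{1-\mathcal G[S,T]^2}$, where $$\mathcal G[S,T]=\sup\{|\langle x,y\rangle|: x\in S\cap(S\cap T)^\perp,\ y\in T\cap(S\cap T)^\perp,\ \|x\|=\|y\|=1\},$$ and $\mathcal G[S,T]=0$ if $S\subseteq T$ or $T\subseteq S$. **Theorem.** Let $\Phi=(\Phi_1,\dots,\Phi_m)$ be a family in $L^2(\Omega,\mathcal H)$ that is a uniform frame for $J$, where $J$ is the measurable range function associated to $M=M_D(\Phi)$. Suppose that $\ell(M)\le\ell\le m$, let $A=(a_{ij})\in\mathbb C^{\ell\times m}$, and let $\Psi=(\Psi_1,\dots,\Psi_\ell)$ with $\Psi_i=\sum_{j=1}^m a_{ij}\Phi_j$. Then $\Psi$ is a uniform frame for $J$ if and only if both of the following hold: 1. $M_D(\Psi)=M$;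 2. there is $\delta>0$ such that $\mathcal F[\operatorname{Ker}(A),\operatorname{Im}(G_{\Phi(\omega)})]\ge\delta$ for a.e. $\omega\in\Omega$, where $G_{\Phi(\omega)}\in\mathbb C^{m\times m}$ is the Gramian $(G_{\Phi(\omega)})_{ij}=\langle\Phi_i(\omega),\Phi_j(\omega)\rangle$, the inner product being linear in its first argument. -/

import Mathlib

open MeasureTheory
open scoped ENNReal

namespace MISpace

noncomputable section

/-- `D ⊆ L^∞(Ω)` is a determining set for `L¹(Ω)`: the only `f ∈ L¹(Ω)` with `∫ f g dμ = 0`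
for every `g ∈ D` is `f = 0`. -/
def IsDeterminingSet {Ω : Type*} [MeasurableSpace Ω] {μ : Measure Ω} (D : Set (Lp ℂ ∞ μ)) : Prop :=
  ∀ f : Lp ℂ 1 μ, (∀ g ∈ D, ∫ ω, f ω * g ω ∂μ = 0) → f = 0

/-- `M_D(S)`, the closed linear span in `L²(Ω, H)` of all products `g Φ` with `g ∈ D`, `Φ ∈ S`.
Here `g • Φ` is the pointwise product of an `L^∞` function and an `L²` function. -/
def generatedBy {Ω H : Type*} [MeasurableSpace Ω] {μ : Measure Ω} [NormedAddCommGroup H]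
    [InnerProductSpace ℂ H] (D : Set (Lp ℂ ∞ μ)) (S : Set (Lp H 2 μ)) : Submodule ℂ (Lp H 2 μ) :=
  (Submodule.span ℂ {F : Lp H 2 μ | ∃ g ∈ D, ∃ Φ ∈ S, F = g • Φ}).topologicalClosure

/-- The length of `M`: the least `n` such that `M = M_D(Φ₁, …, Φₙ)` for some `Φ₁, …, Φₙ ∈ M`.
It is meant for finitely generated `M`, for which the set below is non-empty. -/
def length {Ω H : Type*} [MeasurableSpace Ω] {μ : Measure Ω} [NormedAddCommGroup H]
    [InnerProductSpace ℂ H] (D : Set (Lp ℂ ∞ μ)) (M : Submodule ℂ (Lp H 2 μ)) : ℕ :=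
  sInf {n : ℕ | ∃ Φ : Fin n → Lp H 2 μ, (∀ i, Φ i ∈ M) ∧ M = generatedBy D (Set.range Φ)}

/-- `J : Ω → {closed subspaces of H}` is a measurable range function: `ω ↦ ⟨P_J(ω) a, b⟩` is
measurable for all `a, b ∈ H`. (Mathlib's inner product is linear in its second argument.) -/
def IsMeasurableRangeFunction {Ω H : Type*} [MeasurableSpace Ω] [NormedAddCommGroup H]
    [InnerProductSpace ℂ H] [CompleteSpace H] (J : Ω → ClosedSubmodule ℂ H) : Prop :=
  ∀ a b : H, Measurable fun ω => inner ℂ b ((J ω).toSubmodule.starProjection a)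

/-- `J` is the measurable range function associated to `M`, which is unique up to null sets:
`M = {F ∈ L²(Ω, H) : F(ω) ∈ J(ω) for a.e. ω}`. -/
def IsRangeFunctionOf {Ω H : Type*} [MeasurableSpace Ω] {μ : Measure Ω} [NormedAddCommGroup H]
    [InnerProductSpace ℂ H] [CompleteSpace H] (J : Ω → ClosedSubmodule ℂ H)
    (M : Submodule ℂ (Lp H 2 μ)) : Prop :=
  IsMeasurableRangeFunction J ∧ ∀ F : Lp H 2 μ, F ∈ M ↔ ∀ᵐ ω ∂μ, F ω ∈ J ω

/-- The finite family `v` of vectors of `H` is a frame for the closed subspace `K` with frame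
bounds `0 < α ≤ β`. -/
def IsFrameWithBounds {ι H : Type*} [Fintype ι] [NormedAddCommGroup H] [InnerProductSpace ℂ H]
    (v : ι → H) (K : ClosedSubmodule ℂ H) (α β : ℝ) : Prop :=
  0 < α ∧ α ≤ β ∧ (∀ i, v i ∈ K) ∧
    ∀ f ∈ K, α * ‖f‖ ^ 2 ≤ ∑ i, ‖inner ℂ (v i) f‖ ^ 2 ∧ ∑ i, ‖inner ℂ (v i) f‖ ^ 2 ≤ β * ‖f‖ ^ 2

/-- The finite family `Φ` in `L²(Ω, H)` is a uniform frame for `J`: almost everywhere `J(ω)` is the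
closed span of the `Φᵢ(ω)`, and these form a frame for `J(ω)` with bounds independent of `ω`. -/
def IsUniformFrame {ι Ω H : Type*} [Fintype ι] [MeasurableSpace Ω] {μ : Measure Ω}
    [NormedAddCommGroup H] [InnerProductSpace ℂ H] (Φ : ι → Lp H 2 μ)
    (J : Ω → ClosedSubmodule ℂ H) : Prop :=
  (∀ᵐ ω ∂μ, J ω = (Submodule.span ℂ (Set.range fun i => Φ i ω)).closure) ∧
    ∃ α β : ℝ, 0 < α ∧ α ≤ β ∧ ∀ᵐ ω ∂μ, IsFrameWithBounds (fun i => Φ i ω) (J ω) α β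

/-- The family `Ψ = A Φᵗ`, i.e. `Ψᵢ = ∑ⱼ aᵢⱼ Φⱼ`. -/
def linComb {Ω H : Type*} [MeasurableSpace Ω] {μ : Measure Ω} [NormedAddCommGroup H]
    [InnerProductSpace ℂ H] {l m : ℕ} (A : Matrix (Fin l) (Fin m) ℂ) (Φ : Fin m → Lp H 2 μ) :
    Fin l → Lp H 2 μ :=
  fun i => ∑ j, A i j • Φ j

/-- The set `𝓡` of the matrices `A ∈ ℂ^{l × m}` such that `A Φᵗ` generates `M_D(Φ)`. -/
def generatingMatrices {Ω H : Type*} [MeasurableSpace Ω] {μ : Measure Ω} [NormedAddCommGroup H]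
    [InnerProductSpace ℂ H] {m : ℕ} (D : Set (Lp ℂ ∞ μ)) (Φ : Fin m → Lp H 2 μ) (l : ℕ) :
    Set (Matrix (Fin l) (Fin m) ℂ) :=
  {A | generatedBy D (Set.range Φ) = generatedBy D (Set.range (linComb A Φ))}

/-- The Gramian `Gᵢⱼ = ⟨vᵢ, vⱼ⟩` for the inner product that is linear in its first argument.
Mathlib's is linear in the second, so this is the transpose of `Matrix.gram ℂ v`; with it,
the Gramian of `A vᵗ` is `A G A*`. -/
def gramian {ι H : Type*} [NormedAddCommGroup H] [InnerProductSpace ℂ H] (v : ι → H) :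
    Matrix ι ι ℂ :=
  Matrix.of fun i j => inner ℂ (v j) (v i)

/-- The cosine of the Friedrichs angle between the subspaces `S` and `T`. If one of them contains
the other (in particular if one of them is `0`), the set below is empty and the value is
`sSup ∅ = 0`, as the usual convention requires. -/
def friedrichsCos {E : Type*} [NormedAddCommGroup E] [InnerProductSpace ℂ E]
    (S T : Submodule ℂ E) : ℝ :=
  sSup {r : ℝ | ∃ x ∈ S ⊓ (S ⊓ T)ᗮ, ∃ y ∈ T ⊓ (S ⊓ T)ᗮ,
    ‖x‖ = 1 ∧ ‖y‖ = 1 ∧ r = ‖inner ℂ x y‖}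

/-- The sine of the Friedrichs angle between `S` and `T`. -/
def friedrichsSin {E : Type*} [NormedAddCommGroup E] [InnerProductSpace ℂ E]
    (S T : Submodule ℂ E) : ℝ :=
  Real.sqrt (1 - friedrichsCos S T ^ 2)

/-- `Ker(A) ⊆ ℂ^m`, with the Euclidean inner product on `ℂ^m`. -/
def matrixKer {l m : ℕ} (A : Matrix (Fin l) (Fin m) ℂ) : Submodule ℂ (EuclideanSpace ℂ (Fin m)) :=
  LinearMap.ker (Matrix.toEuclideanLin A)

/-- `Im(G) ⊆ ℂ^l` for `G ∈ ℂ^{l × m}`, with the Euclidean inner product on `ℂ^l`. -/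
def matrixIm {l m : ℕ} (G : Matrix (Fin l) (Fin m) ℂ) : Submodule ℂ (EuclideanSpace ℂ (Fin l)) :=
  LinearMap.range (Matrix.toEuclideanLin G)

end

end MISpace

/-! Everything reduces to one fibre. Because `D` is determining, `M_D(Ψ)` is the space of all `L²`
functions with values in the pointwise closed spans of `Ψ` (`generatedBy_eq_aeMemSubmodule`), so
condition 1 says that `Ψ(ω)` spans `J(ω)` a.e. Let `y` be the vector of frame coefficients of `u ∈
J(ω)` against `Φ(ω)`. Then `y` ranges over `Im G`, `‖y‖` is uniformly comparable to `‖u‖`, and `A y`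
is the coefficient vector of `u` against `Ψ(ω)`. Only the lower bound for `Ψ` is in question, and it
asks for `‖A y‖ ≥ c‖y‖` on `Im G` uniformly in `ω`. As `‖A y‖` is comparable to the distance from
`y` to `Ker A`, this is a uniform angle between `Ker A` and `Im G`, once spanning has made them meet
only in `0`. -/

namespace MISpace

/-! ### Generated spaces described fibre by fibre. -/

section RangeFunctions

variable {Ω H : Type*} [MeasurableSpace Ω] {μ : Measure Ω} [NormedAddCommGroup H]
  [InnerProductSpace ℂ H]

/-- The `L²` functions whose values lie almost everywhere in the prescribed closed subspaces. -/
def aeMemSubmodule (μ : Measure Ω) (K : Ω → ClosedSubmodule ℂ H) : Submodule ℂ (Lp H 2 μ) where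
  carrier := {F | ∀ᵐ ω ∂μ, F ω ∈ K ω}
  add_mem' {F G} hF hG := by
    filter_upwards [hF, hG, Lp.coeFn_add F G] with ω h₁ h₂ h₃
    rw [h₃]
    exact add_mem h₁ h₂
  zero_mem' := by
    filter_upwards [Lp.coeFn_zero H 2 μ] with ω h
    rw [h]
    exact zero_mem _
  smul_mem' c F hF := by
    filter_upwards [hF, Lp.coeFn_smul c F] with ω h₁ h₂
    rw [h₂]
    exact SMulMemClass.smul_mem c h₁

theorem mem_aeMemSubmodule {K : Ω → ClosedSubmodule ℂ H} {F : Lp H 2 μ} :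
    F ∈ aeMemSubmodule μ K ↔ ∀ᵐ ω ∂μ, F ω ∈ K ω :=
  Iff.rfl

/-- An `L²`-convergent sequence has a subsequence converging a.e., and each fibre is closed. -/
theorem isClosed_aeMemSubmodule (K : Ω → ClosedSubmodule ℂ H) :
    IsClosed (aeMemSubmodule μ K : Set (Lp H 2 μ)) := by
  refine IsSeqClosed.isClosed fun u F hu hF => ?_
  obtain ⟨φ, -, hφ⟩ := (tendstoInMeasure_of_tendsto_Lp hF).exists_seq_tendsto_ae
  have hall : ∀ᵐ ω ∂μ, ∀ n, u n ω ∈ K ω := ae_all_iff.2 fun n => hu n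
  change ∀ᵐ ω ∂μ, F ω ∈ K ω
  filter_upwards [hφ, hall] with ω h₁ h₂
  exact (K ω).isClosed.mem_of_tendsto h₁ (Filter.Eventually.of_forall fun n => h₂ _)

theorem generatedBy_le_aeMemSubmodule (D : Set (Lp ℂ ∞ μ)) {S : Set (Lp H 2 μ)}
    {K : Ω → ClosedSubmodule ℂ H} (hS : ∀ Φ ∈ S, ∀ᵐ ω ∂μ, Φ ω ∈ K ω) :
    generatedBy D S ≤ aeMemSubmodule μ K := by
  refine Submodule.topologicalClosure_minimal _ (Submodule.span_le.2 ?_)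
    (isClosed_aeMemSubmodule K)
  rintro _ ⟨g, -, Φ, hΦ, rfl⟩
  change ∀ᵐ ω ∂μ, (g • Φ : Lp H 2 μ) ω ∈ K ω
  filter_upwards [hS Φ hΦ, Lp.coeFn_lpSMul (r := 2) g Φ] with ω h₁ h₂
  rw [h₂]
  exact SMulMemClass.smul_mem _ h₁

theorem smul_mem_generatedBy {D : Set (Lp ℂ ∞ μ)} {S : Set (Lp H 2 μ)} {g : Lp ℂ ∞ μ}
    (hg : g ∈ D) {Φ : Lp H 2 μ} (hΦ : Φ ∈ S) : (g • Φ : Lp H 2 μ) ∈ generatedBy D S :=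
  Submodule.le_topologicalClosure _ (Submodule.subset_span ⟨g, hg, Φ, hΦ, rfl⟩)

/-- A function orthogonal to `M_D(S)` is pointwise orthogonal to the members of `S`. -/
theorem IsDeterminingSet.ae_inner_eq_zero {D : Set (Lp ℂ ∞ μ)} (hD : IsDeterminingSet D)
    {S : Set (Lp H 2 μ)} {F : Lp H 2 μ} (hF : F ∈ (generatedBy D S)ᗮ) {Φ : Lp H 2 μ}
    (hΦ : Φ ∈ S) : ∀ᵐ ω ∂μ, inner ℂ (F ω) (Φ ω) = 0 := by
  have hint := L2.integrable_inner (𝕜 := ℂ) F Φ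
  have h0 : hint.toL1 = 0 := by
    refine hD _ fun g hg => ?_
    have h := (Submodule.mem_orthogonal' _ _).1 hF _ (smul_mem_generatedBy hg hΦ)
    rw [L2.inner_def] at h
    rw [← h]
    refine integral_congr_ae ?_
    filter_upwards [hint.coeFn_toL1, Lp.coeFn_lpSMul (r := 2) g Φ] with ω h₁ h₂
    rw [h₁, h₂, Pi.smul_apply', inner_smul_right, mul_comm]
  have h1 := hint.coeFn_toL1
  rw [h0] at h1
  filter_upwards [h1, Lp.coeFn_zero ℂ 1 μ] with ω h₁ h₂
  rw [← h₁, h₂, Pi.zero_apply]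

theorem linComb_ae_eq {l m : ℕ} (A : Matrix (Fin l) (Fin m) ℂ) (Φ : Fin m → Lp H 2 μ) :
    ∀ᵐ ω ∂μ, ∀ i, linComb A Φ i ω = ∑ j, A i j • Φ j ω := by
  refine ae_all_iff.2 fun i => ?_
  have h1 : ∀ᵐ ω ∂μ, ∀ j, (A i j • Φ j : Lp H 2 μ) ω = A i j • Φ j ω :=
    ae_all_iff.2 fun j => Lp.coeFn_smul _ _
  filter_upwards [h1, Lp.coeFn_finsetSum Finset.univ fun j => A i j • Φ j] with ω h₁ h₂
  rw [linComb, h₂, Finset.sum_apply]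
  exact Finset.sum_congr rfl fun j _ => h₁ j

theorem eq_zero_of_mem_closure_span {ι : Type*} {w : ι → H} {u : H}
    (hu : u ∈ (Submodule.span ℂ (Set.range w)).closure) (h : ∀ i, inner ℂ u (w i) = 0) :
    u = 0 := by
  have h1 : Submodule.span ℂ (Set.range w) ≤ (Submodule.span ℂ {u})ᗮ := by
    rw [Submodule.span_le]
    rintro _ ⟨i, rfl⟩
    exact Submodule.mem_orthogonal_singleton_iff_inner_right.2 (h i)
  have h2 := Submodule.topologicalClosure_minimal _ h1 (Submodule.isClosed_orthogonal _)
    (Submodule.mem_closure_iff.1 hu)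
  exact inner_self_eq_zero.1 (Submodule.mem_orthogonal_singleton_iff_inner_right.1 h2)

/-- `M_D(Ψ)` consists of the functions whose values lie in the pointwise closed span of `Ψ`. -/
theorem generatedBy_eq_aeMemSubmodule [CompleteSpace H] {ι : Type*} [Finite ι]
    {D : Set (Lp ℂ ∞ μ)} (hD : IsDeterminingSet D) (Ψ : ι → Lp H 2 μ) :
    generatedBy D (Set.range Ψ) =
      aeMemSubmodule μ fun ω => (Submodule.span ℂ (Set.range fun i => Ψ i ω)).closure := by
  have hle : generatedBy D (Set.range Ψ) ≤
      aeMemSubmodule μ fun ω => (Submodule.span ℂ (Set.range fun i => Ψ i ω)).closure := by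
    refine generatedBy_le_aeMemSubmodule D ?_
    rintro _ ⟨i, rfl⟩
    exact ae_of_all _ fun ω => Submodule.le_topologicalClosure _ (Submodule.subset_span ⟨i, rfl⟩)
  have : CompleteSpace (generatedBy D (Set.range Ψ)) :=
    (Submodule.isClosed_topologicalClosure _).completeSpace_coe
  refine le_antisymm hle fun F hF => ?_
  set P := generatedBy D (Set.range Ψ) with hP
  -- The residual lies a.e. in the pointwise span and is a.e. orthogonal to it, so it vanishes.
  have hmem : F - P.starProjection F ∈
      aeMemSubmodule μ fun ω => (Submodule.span ℂ (Set.range fun i => Ψ i ω)).closure :=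
    sub_mem hF (hle (Submodule.starProjection_apply_mem _ _))
  have horth : ∀ᵐ ω ∂μ, ∀ i, inner ℂ ((F - P.starProjection F : Lp H 2 μ) ω) (Ψ i ω) = 0 :=
    ae_all_iff.2 fun i => hD.ae_inner_eq_zero
      (Submodule.sub_starProjection_mem_orthogonal (K := P) F) ⟨i, rfl⟩
  have h0 : F - P.starProjection F = 0 := by
    rw [Lp.eq_zero_iff_ae_eq_zero]
    filter_upwards [mem_aeMemSubmodule.1 hmem, horth] with ω h₁ h₂
    exact eq_zero_of_mem_closure_span h₁ h₂
  rw [sub_eq_zero.1 h0]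
  exact Submodule.starProjection_apply_mem _ _

/-- `A Φᵗ` generates `M_D(Φ)` exactly when its values span the fibres. -/
theorem mem_generatingMatrices_iff [CompleteSpace H] {D : Set (Lp ℂ ∞ μ)}
    (hD : IsDeterminingSet D) {l m : ℕ} {Φ : Fin m → Lp H 2 μ} {J : Ω → ClosedSubmodule ℂ H}
    (hJ : ∀ᵐ ω ∂μ, J ω = (Submodule.span ℂ (Set.range fun i => Φ i ω)).closure)
    (A : Matrix (Fin l) (Fin m) ℂ) :
    A ∈ generatingMatrices D Φ l ↔
      ∀ᵐ ω ∂μ, J ω = (Submodule.span ℂ (Set.range fun i => linComb A Φ i ω)).closure := by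
  rw [generatingMatrices, Set.mem_ofPred_eq, generatedBy_eq_aeMemSubmodule hD,
    generatedBy_eq_aeMemSubmodule hD]
  constructor
  · intro h
    have hΦ : ∀ᵐ ω ∂μ, ∀ j,
        Φ j ω ∈ (Submodule.span ℂ (Set.range fun i => linComb A Φ i ω)).closure := by
      refine ae_all_iff.2 fun j => ?_
      rw [← mem_aeMemSubmodule (K := fun ω =>
        (Submodule.span ℂ (Set.range fun i => linComb A Φ i ω)).closure), ← h]
      exact ae_of_all _ fun ω =>
        Submodule.le_topologicalClosure _ (Submodule.subset_span ⟨j, rfl⟩)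
    filter_upwards [hJ, hΦ, linComb_ae_eq A Φ] with ω h₁ h₂ h₃
    rw [h₁]
    apply le_antisymm
    · rw [Submodule.closure_le, Submodule.span_le]
      rintro _ ⟨j, rfl⟩
      exact h₂ j
    · rw [Submodule.closure_le, Submodule.span_le]
      rintro _ ⟨i, rfl⟩
      refine Submodule.le_topologicalClosure _ ?_
      simp only [h₃]
      exact Submodule.sum_mem _ fun j _ =>
        Submodule.smul_mem _ _ (Submodule.subset_span ⟨j, rfl⟩)
  · intro h
    ext F
    simp only [mem_aeMemSubmodule]
    refine Filter.eventually_congr ?_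
    filter_upwards [hJ, h] with ω h₁ h₂
    rw [← h₁, ← h₂]

end RangeFunctions

/-! ### Friedrichs angle and distance to a subspace. -/

section FriedrichsAngle

variable {E : Type*} [NormedAddCommGroup E] [InnerProductSpace ℂ E]

/-- With trivial intersection, `(S ⊓ T)ᗮ` is the whole space, so the supremum runs over all unit
vectors of `S` and `T`; the rest is scaling. -/
theorem norm_inner_le_friedrichsCos {S T : Submodule ℂ E} (h : S ⊓ T = ⊥) {x y : E}
    (hx : x ∈ S) (hy : y ∈ T) : ‖inner ℂ x y‖ ≤ friedrichsCos S T * (‖x‖ * ‖y‖) := by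
  rcases eq_or_ne x 0 with rfl | hx0
  · simp
  rcases eq_or_ne y 0 with rfl | hy0
  · simp
  have hx1 : 0 < ‖x‖ := norm_pos_iff.2 hx0
  have hy1 : 0 < ‖y‖ := norm_pos_iff.2 hy0
  have hb : BddAbove {r : ℝ | ∃ x ∈ S ⊓ (S ⊓ T)ᗮ, ∃ y ∈ T ⊓ (S ⊓ T)ᗮ,
      ‖x‖ = 1 ∧ ‖y‖ = 1 ∧ r = ‖inner ℂ x y‖} := by
    refine ⟨1, ?_⟩
    rintro _ ⟨x, -, y, -, hx, hy, rfl⟩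
    simpa [hx, hy] using norm_inner_le_norm (𝕜 := ℂ) x y
  have key := le_csSup hb ⟨((‖x‖⁻¹ : ℝ) : ℂ) • x, ⟨S.smul_mem _ hx, by simp [h]⟩,
    ((‖y‖⁻¹ : ℝ) : ℂ) • y, ⟨T.smul_mem _ hy, by simp [h]⟩,
    by simp [norm_smul, hx1.ne'], by simp [norm_smul, hy1.ne'], rfl⟩
  rw [← friedrichsCos, inner_smul_left, inner_smul_right] at key
  simp only [norm_mul, RCLike.norm_conj, Complex.norm_real, norm_inv, norm_norm] at key
  calc ‖inner ℂ x y‖ = (‖x‖⁻¹ * (‖y‖⁻¹ * ‖inner ℂ x y‖)) * (‖x‖ * ‖y‖) := by field_simp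
    _ ≤ _ := by gcongr

theorem friedrichsSin_mul_norm_le {S T : Submodule ℂ E} [S.HasOrthogonalProjection]
    (h : S ⊓ T = ⊥) {y : E} (hy : y ∈ T) :
    friedrichsSin S T * ‖y‖ ≤ ‖y - S.starProjection y‖ := by
  set p := S.starProjection y with hp
  have hpS : p ∈ S := Submodule.starProjection_apply_mem _ _
  have horth : inner ℂ p (y - p) = 0 :=
    (Submodule.mem_orthogonal _ _).1 (Submodule.sub_starProjection_mem_orthogonal (K := S) y) _ hpS
  have hpy : ‖inner ℂ p y‖ = ‖p‖ ^ 2 := by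
    rw [inner_sub_right, sub_eq_zero] at horth
    rw [horth, inner_self_eq_norm_sq_to_K]
    simp
  have hpyth : ‖y‖ ^ 2 = ‖p‖ ^ 2 + ‖y - p‖ ^ 2 := by
    have := norm_add_sq_eq_norm_sq_add_norm_sq_of_inner_eq_zero p (y - p) horth
    rw [add_sub_cancel] at this
    linarith [this, sq ‖y‖, sq ‖p‖, sq ‖y - p‖]
  have hcos := norm_inner_le_friedrichsCos h hpS hy
  rw [hpy] at hcos
  have hc : ‖p‖ ≤ |friedrichsCos S T| * ‖y‖ := by
    rcases (norm_nonneg p).eq_or_lt with h0 | h0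
    · rw [← h0]; positivity
    · have : ‖p‖ * ‖p‖ ≤ ‖p‖ * (friedrichsCos S T * ‖y‖) := by linarith
      exact (le_of_mul_le_mul_left this h0).trans
        (mul_le_mul_of_nonneg_right (le_abs_self _) (norm_nonneg _))
  have hc2 : ‖p‖ ^ 2 ≤ friedrichsCos S T ^ 2 * ‖y‖ ^ 2 := by
    rw [← sq_abs (friedrichsCos S T), ← mul_pow]
    gcongr
  rw [friedrichsSin]
  -- `Real.sqrt` is `0` on nonpositive arguments, so no bound on the cosine is needed.
  rcases le_total (1 - friedrichsCos S T ^ 2) 0 with h0 | h0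
  · rw [Real.sqrt_eq_zero_of_nonpos h0, zero_mul]
    positivity
  · refine le_of_sq_le_sq ?_ (norm_nonneg _)
    rw [mul_pow, Real.sq_sqrt h0]
    linarith

theorem le_friedrichsSin {S T : Submodule ℂ E} {δ : ℝ} (h0 : 0 ≤ δ) (h1 : δ ≤ 1)
    (h : ∀ x ∈ S, ∀ y ∈ T, δ * ‖y‖ ≤ ‖y - x‖) : δ ≤ friedrichsSin S T := by
  have hδ : 0 ≤ 1 - δ ^ 2 := by nlinarith
  have hcos : friedrichsCos S T ≤ √(1 - δ ^ 2) := by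
    -- Nonnegativity of the bound covers an empty set, where the cosine is `0`.
    refine Real.sSup_le ?_ (Real.sqrt_nonneg _)
    rintro _ ⟨x, hx, y, hy, hx1, hy1, rfl⟩
    refine Real.le_sqrt_of_sq_le ?_
    -- The test vector is the projection of `y` onto the line of `x`.
    have h2 := h (inner ℂ x y • x) (S.smul_mem _ hx.1) y hy.1
    rw [hy1, mul_one] at h2
    have h3 : ‖y - inner ℂ x y • x‖ ^ 2 = 1 - ‖inner ℂ x y‖ ^ 2 := by
      rw [@norm_sub_sq ℂ, inner_smul_right, norm_smul, hx1, hy1, ← inner_conj_symm y x,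
        Complex.mul_conj', ← Complex.ofReal_pow, RCLike.re_eq_complex_re, Complex.ofReal_re]
      ring
    have h4 : δ ^ 2 ≤ ‖y - inner ℂ x y • x‖ ^ 2 := by gcongr
    linarith
  have hnn : 0 ≤ friedrichsCos S T := by
    refine Real.sSup_nonneg ?_
    rintro _ ⟨x, -, y, -, -, -, rfl⟩
    exact norm_nonneg _
  refine Real.le_sqrt_of_sq_le ?_
  have := Real.sq_sqrt hδ
  have h5 : friedrichsCos S T ^ 2 ≤ √(1 - δ ^ 2) ^ 2 := by gcongr
  linarith

/-- `L` is injective on `(ker L)ᗮ`, hence bounded below there by finite dimension. -/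
theorem exists_pos_mul_norm_sub_starProjection_ker_le {F : Type*} [NormedAddCommGroup F]
    [InnerProductSpace ℂ F] [FiniteDimensional ℂ E] (L : E →ₗ[ℂ] F) :
    ∃ c : ℝ, 0 < c ∧ ∀ y, c * ‖y - (LinearMap.ker L).starProjection y‖ ≤ ‖L y‖ := by
  have hker : LinearMap.ker (L.domRestrict (LinearMap.ker L)ᗮ) = ⊥ := by
    rw [LinearMap.ker_eq_bot']
    rintro ⟨z, hz⟩ h0
    have : z ∈ LinearMap.ker L ⊓ (LinearMap.ker L)ᗮ := ⟨h0, hz⟩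
    rw [Submodule.inf_orthogonal_eq_bot] at this
    exact Subtype.ext this
  obtain ⟨k, hk, hL⟩ := LinearMap.exists_antilipschitzWith _ hker
  have hk' : (0 : ℝ) < k := hk
  refine ⟨(k : ℝ)⁻¹, inv_pos.2 hk', fun y => ?_⟩
  have h1 := ZeroHomClass.bound_of_antilipschitz _ hL
    ⟨y - (LinearMap.ker L).starProjection y, Submodule.sub_starProjection_mem_orthogonal y⟩
  have h2 : L ((LinearMap.ker L).starProjection y) = 0 :=
    Submodule.starProjection_apply_mem (LinearMap.ker L) y
  rw [LinearMap.domRestrict_apply, map_sub, h2, sub_zero] at h1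
  rw [inv_mul_le_iff₀ hk']
  exact h1

end FriedrichsAngle

/-! ### Frame bounds on a single fibre. -/

section Frames

variable {H : Type*} [NormedAddCommGroup H] [InnerProductSpace ℂ H]

/-- The conjugate-linear analysis map `u ↦ (⟨u, vᵢ⟩)ᵢ` (linear in the first argument). -/
noncomputable def coeffs {n : ℕ} (v : Fin n → H) (u : H) : EuclideanSpace ℂ (Fin n) :=
  WithLp.toLp 2 fun i => inner ℂ u (v i)

theorem norm_coeffs_sq {n : ℕ} (v : Fin n → H) (u : H) :
    ‖coeffs v u‖ ^ 2 = ∑ i, ‖inner ℂ (v i) u‖ ^ 2 := by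
  rw [EuclideanSpace.norm_sq_eq]
  exact Finset.sum_congr rfl fun i _ => by rw [coeffs, norm_inner_symm]

theorem toEuclideanLin_coeffs {l m : ℕ} (A : Matrix (Fin l) (Fin m) ℂ) (v : Fin m → H) (u : H) :
    Matrix.toEuclideanLin A (coeffs v u) = coeffs (fun i => ∑ j, A i j • v j) u := by
  ext i
  simp [coeffs, Matrix.toLpLin_apply, Matrix.mulVec, dotProduct]

theorem toEuclideanLin_gramian {m : ℕ} (v : Fin m → H) (c : EuclideanSpace ℂ (Fin m)) :
    Matrix.toEuclideanLin (gramian v) c = coeffs v (∑ j, (starRingEnd ℂ) (c j) • v j) := by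
  ext i
  simp [coeffs, gramian, Matrix.toLpLin_apply, Matrix.mulVec, dotProduct]

/-- Identifies `Im G` with the coefficient vectors of the span. Scalars get conjugated because the
analysis map is conjugate-linear. -/
theorem mem_matrixIm_gramian {m : ℕ} (v : Fin m → H) (y : EuclideanSpace ℂ (Fin m)) :
    y ∈ matrixIm (gramian v) ↔ ∃ u ∈ Submodule.span ℂ (Set.range v), coeffs v u = y := by
  constructor
  · rintro ⟨c, rfl⟩
    exact ⟨_, Submodule.sum_mem _ fun j _ => Submodule.smul_mem _ _ (Submodule.subset_span ⟨j, rfl⟩),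
      (toEuclideanLin_gramian v c).symm⟩
  · rintro ⟨u, hu, rfl⟩
    obtain ⟨c, rfl⟩ := (Submodule.mem_span_range_iff_exists_fun ℂ).1 hu
    refine ⟨WithLp.toLp 2 fun j => (starRingEnd ℂ) (c j), ?_⟩
    rw [toEuclideanLin_gramian]
    simp

theorem exists_pos_norm_toEuclideanLin_le {l m : ℕ} (A : Matrix (Fin l) (Fin m) ℂ) :
    ∃ N : ℝ, 0 < N ∧ ∀ y, ‖Matrix.toEuclideanLin A y‖ ≤ N * ‖y‖ := by
  refine ⟨‖(Matrix.toEuclideanLin A).toContinuousLinearMap‖ + 1, by positivity, fun y => ?_⟩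
  refine ((Matrix.toEuclideanLin A).toContinuousLinearMap.le_opNorm y).trans ?_
  gcongr
  linarith

theorem IsFrameWithBounds.norm_coeffs_le {n : ℕ} {v : Fin n → H} {K : ClosedSubmodule ℂ H}
    {α β : ℝ} (h : IsFrameWithBounds v K α β) {u : H} (hu : u ∈ K) :
    ‖coeffs v u‖ ≤ √β * ‖u‖ := by
  have h0 : 0 ≤ β := h.1.le.trans h.2.1
  refine le_of_sq_le_sq ?_ (by positivity)
  rw [norm_coeffs_sq, mul_pow, Real.sq_sqrt h0]
  exact (h.2.2.2 u hu).2

theorem IsFrameWithBounds.le_norm_coeffs {n : ℕ} {v : Fin n → H} {K : ClosedSubmodule ℂ H}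
    {α β : ℝ} (h : IsFrameWithBounds v K α β) {u : H} (hu : u ∈ K) :
    √α * ‖u‖ ≤ ‖coeffs v u‖ := by
  refine le_of_sq_le_sq ?_ (norm_nonneg _)
  rw [norm_coeffs_sq, mul_pow, Real.sq_sqrt h.1.le]
  exact (h.2.2.2 u hu).1

/-- `δ` is chosen before `v` and `K`, so one value serves almost every fibre. -/
theorem exists_le_friedrichsSin_of_frame {l m : ℕ} (A : Matrix (Fin l) (Fin m) ℂ) {β α' : ℝ}
    (hβ : 0 < β) (hα' : 0 < α') :
    ∃ δ : ℝ, 0 < δ ∧ ∀ (v : Fin m → H) (K : ClosedSubmodule ℂ H) (α β' : ℝ),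
      IsFrameWithBounds v K α β →
      IsFrameWithBounds (fun i => ∑ j, A i j • v j) K α' β' →
      δ ≤ friedrichsSin (matrixKer A) (matrixIm (gramian v)) := by
  obtain ⟨N, hN, hA⟩ := exists_pos_norm_toEuclideanLin_le A
  have hβ' : 0 < √β := Real.sqrt_pos.2 hβ
  have hα'' : 0 < √α' := Real.sqrt_pos.2 hα'
  -- The ratio comes from `√α'‖u‖ ≤ ‖A(y - x)‖ ≤ N‖y - x‖` and `‖y‖ ≤ √β‖u‖`; the cap at `1` is
  -- there because a sine is at most `1`.
  have hδ : 0 < min 1 (√α' / (√β * N)) := by positivity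
  refine ⟨_, hδ, fun v K α β' hv hw => le_friedrichsSin hδ.le (min_le_left _ _) ?_⟩
  intro x hx y hy
  obtain ⟨u, hu, rfl⟩ := (mem_matrixIm_gramian v y).1 hy
  have huK : u ∈ K := by
    have : Submodule.span ℂ (Set.range v) ≤ K.toSubmodule := by
      rw [Submodule.span_le]
      rintro _ ⟨i, rfl⟩
      exact hv.2.2.1 i
    exact this hu
  have hx0 : Matrix.toEuclideanLin A x = 0 := hx
  have h1 := hA (coeffs v u - x)
  rw [map_sub, hx0, sub_zero, toEuclideanLin_coeffs] at h1
  have h2 := (hw.le_norm_coeffs huK).trans h1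
  calc min 1 (√α' / (√β * N)) * ‖coeffs v u‖
      ≤ √α' / (√β * N) * (√β * ‖u‖) := by
        gcongr
        · exact min_le_right _ _
        · exact hv.norm_coeffs_le huK
    _ = (√α' * ‖u‖) / N := by field_simp
    _ ≤ ‖coeffs v u - x‖ := by rw [div_le_iff₀ hN]; linarith

theorem exists_frame_of_le_friedrichsSin {l m : ℕ} (A : Matrix (Fin l) (Fin m) ℂ) {α β δ : ℝ}
    (hα : 0 < α) (hβ : 0 < β) (hδ : 0 < δ) :
    ∃ α' β' : ℝ, 0 < α' ∧ α' ≤ β' ∧ ∀ (v : Fin m → H) (K : ClosedSubmodule ℂ H),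
      IsFrameWithBounds v K α β → K = (Submodule.span ℂ (Set.range v)).closure →
      K = (Submodule.span ℂ (Set.range fun i => ∑ j, A i j • v j)).closure →
      δ ≤ friedrichsSin (matrixKer A) (matrixIm (gramian v)) →
      IsFrameWithBounds (fun i => ∑ j, A i j • v j) K α' β' := by
  obtain ⟨N, hN, hA⟩ := exists_pos_norm_toEuclideanLin_le A
  obtain ⟨c, hc, hcA⟩ := exists_pos_mul_norm_sub_starProjection_ker_le (Matrix.toEuclideanLin A)
  have hα' : 0 < (c * δ) ^ 2 * α := by positivity
  -- The upper bound `N ^ 2 * β` would do; the extra term only forces `α' ≤ β'`.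
  have hle : (c * δ) ^ 2 * α ≤ N ^ 2 * β + (c * δ) ^ 2 * α :=
    le_add_of_nonneg_left (by positivity)
  refine ⟨_, _, hα', hle, fun v K hv hKv hKw hF => ⟨hα', hle, fun i => ?_, fun u hu => ?_⟩⟩
  · rw [hKw]
    exact Submodule.le_topologicalClosure _ (Submodule.subset_span ⟨i, rfl⟩)
  rw [← norm_coeffs_sq, ← toEuclideanLin_coeffs]
  have hspan : u ∈ Submodule.span ℂ (Set.range v) := by
    have : FiniteDimensional ℂ (Submodule.span ℂ (Set.range v)) :=
      FiniteDimensional.span_of_finite ℂ (Set.finite_range v)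
    rw [hKv, Submodule.mem_closure_iff,
      (Submodule.closed_of_finiteDimensional _).submodule_topologicalClosure_eq] at hu
    exact hu
  -- A coefficient vector killed by `A` comes from a `z ∈ K` orthogonal to the new family, which
  -- spans `K`.
  have hdisj : matrixKer A ⊓ matrixIm (gramian v) = ⊥ := by
    rw [eq_bot_iff]
    rintro y ⟨hy1, hy2⟩
    obtain ⟨z, hz, rfl⟩ := (mem_matrixIm_gramian v y).1 hy2
    have hzK : z ∈ (Submodule.span ℂ (Set.range fun i => ∑ j, A i j • v j)).closure := by
      rw [← hKw, hKv]
      exact Submodule.le_topologicalClosure _ hz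
    have hz0 : Matrix.toEuclideanLin A (coeffs v z) = 0 := hy1
    rw [toEuclideanLin_coeffs] at hz0
    have : z = 0 := eq_zero_of_mem_closure_span hzK fun i =>
      congrArg (fun y : EuclideanSpace ℂ (Fin l) => y i) hz0
    rw [this]
    ext i
    simp [coeffs]
  have hlow := friedrichsSin_mul_norm_le hdisj ((mem_matrixIm_gramian v _).2 ⟨u, hspan, rfl⟩)
  constructor
  · calc (c * δ) ^ 2 * α * ‖u‖ ^ 2 = (c * (δ * (√α * ‖u‖))) ^ 2 := by
          rw [mul_pow, mul_pow, mul_pow, mul_pow, Real.sq_sqrt hα.le]; ring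
      _ ≤ (c * (friedrichsSin (matrixKer A) (matrixIm (gramian v)) * ‖coeffs v u‖)) ^ 2 := by
          have := hδ.le.trans hF
          gcongr
          exact hv.le_norm_coeffs hu
      _ ≤ (c * ‖coeffs v u - (matrixKer A).starProjection (coeffs v u)‖) ^ 2 := by
          have : 0 ≤ friedrichsSin (matrixKer A) (matrixIm (gramian v)) := hδ.le.trans hF
          gcongr
      _ ≤ ‖Matrix.toEuclideanLin A (coeffs v u)‖ ^ 2 := by
          gcongr
          exact hcA _
  · calc ‖Matrix.toEuclideanLin A (coeffs v u)‖ ^ 2 ≤ (N * (√β * ‖u‖)) ^ 2 := by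
          gcongr
          exact (hA _).trans (by gcongr; exact hv.norm_coeffs_le hu)
      _ = N ^ 2 * β * ‖u‖ ^ 2 := by rw [mul_pow, mul_pow, Real.sq_sqrt hβ.le]; ring
      _ ≤ _ := by gcongr; linarith

end Frames

end MISpace

theorem theorem3p6 {Ω H : Type*} [MeasurableSpace Ω] {μ : Measure Ω} [SigmaFinite μ]
    [NormedAddCommGroup H] [InnerProductSpace ℂ H] [CompleteSpace H]
    [TopologicalSpace.SeparableSpace H]
    (D : Set (Lp ℂ ∞ μ)) (hD : MISpace.IsDeterminingSet D)
    {m l : ℕ} (Φ : Fin m → Lp H 2 μ) (J : Ω → ClosedSubmodule ℂ H)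
    (hJ : MISpace.IsRangeFunctionOf J (MISpace.generatedBy D (Set.range Φ)))
    (hΦ : MISpace.IsUniformFrame Φ J)
    (hl : MISpace.length D (MISpace.generatedBy D (Set.range Φ)) ≤ l) (hlm : l ≤ m)
    (A : Matrix (Fin l) (Fin m) ℂ) :
    MISpace.IsUniformFrame (MISpace.linComb A Φ) J ↔
      A ∈ MISpace.generatingMatrices D Φ l ∧
        ∃ δ : ℝ, 0 < δ ∧ ∀ᵐ ω ∂μ,
          δ ≤ MISpace.friedrichsSin (MISpace.matrixKer A)
            (MISpace.matrixIm (MISpace.gramian fun i => Φ i ω)) := by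
  obtain ⟨hspan, α, β, hα, hαβ, hframe⟩ := hΦ
  have hβ : 0 < β := hα.trans_le hαβ
  rw [MISpace.mem_generatingMatrices_iff hD hspan]
  constructor
  · rintro ⟨hspan', α', β', hα', -, hframe'⟩
    obtain ⟨δ, hδ, h⟩ := MISpace.exists_le_friedrichsSin_of_frame (H := H) A hβ hα'
    refine ⟨hspan', δ, hδ, ?_⟩
    filter_upwards [hframe, hframe', MISpace.linComb_ae_eq A Φ] with ω h₁ h₂ h₃
    simp only [h₃] at h₂
    exact h _ _ _ _ h₁ h₂
  · rintro ⟨hspan', δ, hδ, hF⟩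
    obtain ⟨α', β', hα', hαβ', h⟩ :=
      MISpace.exists_frame_of_le_friedrichsSin (H := H) A hα hβ hδ
    refine ⟨hspan', α', β', hα', hαβ', ?_⟩
    filter_upwards [hspan, hspan', hframe, hF, MISpace.linComb_ae_eq A Φ] with ω h₁ h₂ h₃ h₄ h₅
    simp only [h₅] at h₂ ⊢
    exact h _ _ h₃ h₁ h₂ h₄
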